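/- Let $\alpha>1$ (the path loss exponent) and $\beta\ge 1$ (the uniform threshold) be fixed. A link $i$ on the real line is a pair of distinct points, a sender $s_i$ and a receiver $r_i$. Write $l_i=|s_i-r_i|$, $d_{ij}=|s_i-r_j|$, let $d(i,j)$ be the minimum distance between a node of $i$ and a node of $j$, and let $\mathfrak l_i=\beta^{1/\alpha}l_i$. For a finite nonempty set $L$ of links put $\Delta(L)=\max_{i,j\in L}\mathfrak l_i/\mathfrak l_j$. A set $S$ of links is feasible if there are powers $P(i)>0$ such that $P(i)/l_i^{\alpha}>\beta\sum_{j\in S\setminus\{i\}}P(j)/d_{ji}^{\alpha}$ for every $i\in S$ (a term with $d_{ji}=0$ counts as $+\infty$). For a function $f$, the conflict graph $G_f(L)$ has vertex set $L$, and distinct $i,j\in L$ are adjacent if and only if $d_{ij}d_{ji}<\mathfrak l_i\mathfrak l_j f(\mathfrak l_{\max}/\mathfrak l_{\min})$, where $\mathfrak l_{\max}$ and $\mathfrak l_{\min}$ are the larger and the smaller of $\mathfrak l_i,\mathfrak l_j$; in its simplified form for uniform thresholds, $i,j$ are adjacent if and only if $d(i,j)<\mathfrak l_{\min}f(\mathfrak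 l_{\max}/\mathfrak l_{\min})$. Let $\log^*x$ be the least number of applications of $\log_2$ that take $x$ to a value at most $1$. Theorem. Let $f(x)=O(\log^{1/\alpha}x)$ as $x\to\infty$. There are constants $c_1,c_2>0$ (depending only on $\alpha,\beta,f$) such that for every $\Delta>0$ there is a finite set $L$ of links on the real line with $\Delta(L)\ge c_1\Delta$, such that $G_f(L)$ has no edges (in either form of its definition), but $L$ cannot be partitioned into fewer than $c_2\log^*\Delta(L)$ feasible subsets. -/

import Mathlib

open Asymptotics Filter

namespace SINR

/-- A communication link in a metric space: a sender node and a receiver node, at distinct points. -/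
structure Link (X : Type*) [MetricSpace X] where
  sender : X
  receiver : X
  ne : sender ≠ receiver

variable {X : Type*} [MetricSpace X]

/-- The length `l_i = d(s_i, r_i)` of a link. -/
noncomputable def len (i : Link X) : ℝ := dist i.sender i.receiver

/-- The asymmetric distance `d_ij = d(s_i, r_j)`. -/
noncomputable def sr (i j : Link X) : ℝ := dist i.sender j.receiver

/-- The symmetric distance `d(i, j)`: the minimum distance between a node of `i` and a node of `j`. -/
noncomputable def nodeDist (i j : Link X) : ℝ :=
  min (min (dist i.sender j.sender) (dist i.sender j.receiver))
    (min (dist i.receiver j.sender) (dist i.receiver j.receiver))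

/-- The sensitivity `β ^ (1/α) * l_i` of a link, for path loss exponent `α` and the uniform
threshold `β`. -/
noncomputable def sens (α β : ℝ) (i : Link X) : ℝ := β ^ (1 / α) * len i

/-- The sensitivity diversity of a set of links: the largest ratio of two sensitivities. -/
noncomputable def diversity (α β : ℝ) (L : Finset (Link X)) : ℝ :=
  sSup {x : ℝ | ∃ i ∈ L, ∃ j ∈ L, x = sens α β i / sens α β j}

theorem nodeDist_comm (i j : Link X) : nodeDist i j = nodeDist j i := by
  unfold nodeDist
  rw [dist_comm j.sender i.sender, dist_comm j.sender i.receiver,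
    dist_comm j.receiver i.sender, dist_comm j.receiver i.receiver]
  simp only [min_assoc, min_left_comm]

/-- The conflict graph `G_f(L)`: distinct links `i`, `j` of `L` are adjacent if and only if
`d_ij * d_ji < sens i * sens j * f (sens_max / sens_min)`. -/
noncomputable def conflictGraph (α β : ℝ) (f : ℝ → ℝ) (L : Finset (Link X)) :
    SimpleGraph {i : Link X // i ∈ L} where
  Adj i j := i ≠ j ∧ sr i.1 j.1 * sr j.1 i.1 < sens α β i.1 * sens α β j.1 *
    f (max (sens α β i.1) (sens α β j.1) / min (sens α β i.1) (sens α β j.1))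
  symm := ⟨by
    rintro i j ⟨hne, h⟩
    refine ⟨hne.symm, ?_⟩
    rwa [mul_comm (sr j.1 i.1), mul_comm (sens α β j.1), max_comm, min_comm]⟩
  loopless := ⟨fun _ h => h.1 rfl⟩

/-- The simplified form of the conflict graph used for uniform thresholds: distinct links `i`, `j`
of `L` are adjacent if and only if `d(i, j) < sens_min * f (sens_max / sens_min)`. -/
noncomputable def conflictGraphUniform (α β : ℝ) (f : ℝ → ℝ) (L : Finset (Link X)) :
    SimpleGraph {i : Link X // i ∈ L} where
  Adj i j := i ≠ j ∧ nodeDist i.1 j.1 < min (sens α β i.1) (sens α β j.1) *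
    f (max (sens α β i.1) (sens α β j.1) / min (sens α β i.1) (sens α β j.1))
  symm := ⟨by
    rintro i j ⟨hne, h⟩
    refine ⟨hne.symm, ?_⟩
    rwa [nodeDist_comm, max_comm, min_comm (sens α β j.1)]⟩
  loopless := ⟨fun _ h => h.1 rfl⟩

open Classical in
/-- `S` is `P`-feasible: for each link `i` of `S`, the signal `P i / l_i ^ α` exceeds `β` times the
total interference of the other links of `S`. A sender located at the receiver of `i` causes
infinite interference, which is excluded by the first clause. -/
def FeasibleWith (α β : ℝ) (P : Link X → ℝ) (S : Finset (Link X)) : Prop :=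
  ∀ i ∈ S, (∀ j ∈ S, j ≠ i → 0 < sr j i) ∧
    β * ∑ j ∈ S.erase i, P j / sr j i ^ α < P i / len i ^ α

/-- `S` is feasible if it is `P`-feasible for some assignment `P` of positive powers. -/
def Feasible (α β : ℝ) (S : Finset (Link X)) : Prop :=
  ∃ P : Link X → ℝ, (∀ i, 0 < P i) ∧ FeasibleWith α β P S

/-- `L` can be partitioned into at most `k` feasible subsets, given as the classes of a coloring
with colors `0, …, k - 1`. -/
def CanPartition (α β : ℝ) (L : Finset (Link X)) (k : ℕ) : Prop :=
  ∃ col : Link X → ℕ, (∀ i ∈ L, col i < k) ∧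
    ∀ c < k, Feasible α β (L.filter fun i => col i = c)

/-- The iterated logarithm: the least number of applications of `log₂` that takes `x` to a
value at most `1`. -/
noncomputable def logStar (x : ℝ) : ℕ := sInf {n : ℕ | (Real.logb 2)^[n] x ≤ 1}

end SINR

/-! The set is built recursively, one extra feasible class per level. Given `L` inside `[0, 3]`,
with lengths in `[1 / N, 1]`, that needs `t` classes, take the link from `0` to `1` and put scaled
copies of `L` to the right of its receiver. Copy `k` has scale `2 ^ (-g * (k + 1))` and sits at
distance `offset α B g k`, which is the scale times a constant times `(g * (k + 1)) ^ (1 / α)`. This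
distance is just large enough to avoid every conflict allowed by `f = O(log ^ (1 / α))`.

In a feasible set the powers cancel along two-cycles (`Feasible.sum_lt_one`): the numbers `(l_i *
l_j / (d_ij * d_ji)) ^ α`, summed over the other links `i`, stay below `1`. With `j` the unit link,
any link of copy `k` contributes at least a constant, depending on `N` and `g`, times `1 / (k + 1)`.
As the harmonic series diverges, for large `K` no feasible set contains the unit link and a link of
each of the `K` copies (`IsHard.not_feasible`). So the class of the unit link misses some copy,
which needs `t` classes by itself, and `t + 1` are needed in all (`IsHard.succ`).

The price is `K` exponential in a power of `N`, hence a new length ratio of at most three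
exponentials of `N` (`eventually_isHard_succ`). Thus `t + 1` classes are forced with diversity at
most `tower (3 * t + m)`, whose iterated logarithm is linear in `t`. -/

namespace SINR

/-! ### Feasibility without reference to powers. -/

section Feasibility

variable {X : Type*} [MetricSpace X]

theorem len_pos (i : Link X) : 0 < len i := dist_pos.2 i.ne

theorem sr_nonneg (i j : Link X) : 0 ≤ sr i j := dist_nonneg

theorem Feasible.mono {α β : ℝ} (hβ : 0 ≤ β) {S T : Finset (Link X)} (hT : Feasible α β T)
    (h : S ⊆ T) : Feasible α β S := by
  classical
  obtain ⟨P, hP, hF⟩ := hT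
  refine ⟨P, hP, fun i hi => ⟨fun j hj hne => (hF i (h hi)).1 j (h hj) hne, ?_⟩⟩
  refine lt_of_le_of_lt (mul_le_mul_of_nonneg_left ?_ hβ) (hF i (h hi)).2
  exact Finset.sum_le_sum_of_subset_of_nonneg (Finset.erase_subset_erase _ h)
    fun j _ _ => div_nonneg (hP j).le (Real.rpow_nonneg (sr_nonneg _ _) _)

/-- The cycles of length two through a link `j` of a feasible set have total weight below one. -/
theorem Feasible.sum_lt_one {α β : ℝ} (hβ : 1 ≤ β) {S : Finset (Link X)} (hS : Feasible α β S)
    {j : Link X} (hj : j ∈ S) {ι : Type*} {s : Finset ι} {e : ι → Link X}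
    (he : Set.InjOn e s) (hmem : ∀ k ∈ s, e k ∈ S) (hne : ∀ k ∈ s, e k ≠ j) :
    ∑ k ∈ s, (len (e k) * len j / (sr (e k) j * sr j (e k))) ^ α < 1 := by
  classical
  obtain ⟨P, hP, hF⟩ := hS
  have hlj := len_pos j
  have hβ0 : 0 < β := by linarith
  have h1 : β * ∑ k ∈ s, P (e k) / sr (e k) j ^ α < P j / len j ^ α := by
    refine lt_of_le_of_lt (mul_le_mul_of_nonneg_left ?_ hβ0.le) (hF j hj).2
    rw [← Finset.sum_image (f := fun i => P i / sr i j ^ α) he]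
    refine Finset.sum_le_sum_of_subset_of_nonneg ?_
      fun i _ _ => div_nonneg (hP i).le (Real.rpow_nonneg (sr_nonneg _ _) _)
    intro i hi
    obtain ⟨k, hk, rfl⟩ := Finset.mem_image.1 hi
    exact Finset.mem_erase.2 ⟨hne k hk, hmem k hk⟩
  have h2 : ∀ k ∈ s, (len (e k) * len j / (sr (e k) j * sr j (e k))) ^ α
      ≤ (len j ^ α / P j) * (P (e k) / sr (e k) j ^ α) := by
    intro k hk
    have hle := len_pos (e k)
    have ha := (hF j hj).1 (e k) (hmem k hk) (hne k hk)
    have hb := (hF (e k) (hmem k hk)).1 j hj (hne k hk).symm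
    -- The constraint at `e k`, with only the interference of `j` kept, bounds `P j` by a multiple
    -- of `P (e k)`. Inserted into the constraint at `j`, it eliminates all powers.
    have h3 : P j / sr j (e k) ^ α ≤ P (e k) / len (e k) ^ α := by
      have h4 : P j / sr j (e k) ^ α ≤ ∑ i ∈ S.erase (e k), P i / sr i (e k) ^ α :=
        Finset.single_le_sum (f := fun i => P i / sr i (e k) ^ α)
          (fun i _ => div_nonneg (hP i).le (Real.rpow_nonneg (sr_nonneg _ _) _))
          (Finset.mem_erase.2 ⟨(hne k hk).symm, hj⟩)
      have h5 : 0 ≤ P j / sr j (e k) ^ α :=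
        div_nonneg (hP j).le (Real.rpow_nonneg (sr_nonneg _ _) _)
      nlinarith [(hF (e k) (hmem k hk)).2]
    rw [Real.div_rpow (by positivity) (by positivity), Real.mul_rpow hle.le hlj.le,
      Real.mul_rpow ha.le hb.le]
    have p1 := Real.rpow_pos_of_pos hle α
    have p2 := Real.rpow_pos_of_pos hlj α
    have p3 := Real.rpow_pos_of_pos ha α
    have p4 := Real.rpow_pos_of_pos hb α
    have q1 := hP j
    rw [div_le_div_iff₀ p4 p1] at h3
    rw [div_mul_div_comm, div_le_div_iff₀ (by positivity) (by positivity)]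
    have := mul_le_mul_of_nonneg_left h3 (mul_pos p2 p3).le
    linarith
  refine lt_of_le_of_lt (Finset.sum_le_sum h2) ?_
  rw [← Finset.mul_sum]
  have hsum : 0 ≤ ∑ k ∈ s, P (e k) / sr (e k) j ^ α :=
    Finset.sum_nonneg fun k _ => div_nonneg (hP _).le (Real.rpow_nonneg (sr_nonneg _ _) _)
  have p2 := Real.rpow_pos_of_pos hlj α
  have h6 : ∑ k ∈ s, P (e k) / sr (e k) j ^ α < P j / len j ^ α := by nlinarith
  have q1 := hP j
  rw [lt_div_iff₀ p2] at h6
  rw [div_mul_eq_mul_div, div_lt_one q1]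
  linarith

theorem le_nodeDist_iff {i j : Link X} {D : ℝ} : D ≤ nodeDist i j ↔
    (D ≤ dist i.sender j.sender ∧ D ≤ dist i.sender j.receiver) ∧
      D ≤ dist i.receiver j.sender ∧ D ≤ dist i.receiver j.receiver := by
  simp only [nodeDist, le_min_iff]

/-- Links whose nodes are far apart compared with the shorter link have a large product of
asymmetric distances. -/
theorem mul_le_sr_mul_sr {i j : Link X} {a : ℝ} (ha : 1 ≤ a) (h : 4 * len i * a ≤ nodeDist i j) :
    len i * len j * a ≤ sr i j * sr j i := by
  have hi := len_pos i
  have hj := len_pos j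
  obtain ⟨⟨-, h1⟩, h2, -⟩ := le_nodeDist_iff.1 h
  have h2' : 4 * len i * a ≤ sr j i := by rwa [dist_comm] at h2
  have h1' : 4 * len i * a ≤ sr i j := h1
  -- As `len i` is at most a quarter of either asymmetric distance, the larger of the two is at
  -- least `len j / 4`, and the smaller is at least `4 * len i * a`.
  have tri : len j ≤ sr j i + len i + sr i j := by
    have t1 := dist_triangle4 j.sender i.receiver i.sender j.receiver
    rw [dist_comm i.receiver i.sender] at t1
    exact t1
  have hia : len i ≤ len i * a := by nlinarith
  rcases le_total (sr i j) (sr j i) with hh | hh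
  · have : len j / 4 ≤ sr j i := by linarith
    have := mul_le_mul h1' this (by linarith) (by linarith)
    linarith
  · have : len j / 4 ≤ sr i j := by linarith
    have := mul_le_mul h2' this (by linarith) (by linarith)
    linarith

end Feasibility

/-! ### Invariance under similarities of the line. -/

/-- The image of a link of the real line under `x ↦ a * x + b`. -/
noncomputable def affine (a b : ℝ) (ha : 0 < a) (i : Link ℝ) : Link ℝ where
  sender := a * i.sender + b
  receiver := a * i.receiver + b
  ne := fun h => i.ne (mul_left_cancel₀ ha.ne' (add_right_cancel h))

section Affine

variable {a b : ℝ} (ha : 0 < a)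

theorem dist_affine (a b x y : ℝ) (ha : 0 < a) : dist (a * x + b) (a * y + b) = a * dist x y := by
  rw [dist_add_right, Real.dist_eq, ← mul_sub, abs_mul, abs_of_pos ha, Real.dist_eq]

theorem affine_injective : Function.Injective (affine a b ha) := by
  rintro ⟨s, r, h⟩ ⟨s', r', h'⟩ e
  simp only [affine, Link.mk.injEq, add_left_inj] at e
  obtain ⟨e1, e2⟩ := e
  obtain rfl := mul_left_cancel₀ ha.ne' e1
  obtain rfl := mul_left_cancel₀ ha.ne' e2
  rfl

theorem len_affine (i : Link ℝ) : len (affine a b ha i) = a * len i := dist_affine _ _ _ _ ha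

theorem sr_affine (i j : Link ℝ) : sr (affine a b ha i) (affine a b ha j) = a * sr i j :=
  dist_affine _ _ _ _ ha

theorem nodeDist_affine (i j : Link ℝ) :
    nodeDist (affine a b ha i) (affine a b ha j) = a * nodeDist i j := by
  simp only [nodeDist, affine, dist_affine _ _ _ _ ha, mul_min_of_nonneg _ _ ha.le]

open Classical in
theorem Feasible.of_image_affine {α β : ℝ} {S : Finset (Link ℝ)}
    (h : Feasible α β (S.image (affine a b ha))) : Feasible α β S := by
  obtain ⟨P, hP, hF⟩ := h
  refine ⟨fun i => P (affine a b ha i), fun i => hP _, fun i hi => ?_⟩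
  obtain ⟨h1, h2⟩ := hF _ (Finset.mem_image_of_mem _ hi)
  refine ⟨fun j hj hne => ?_, ?_⟩
  · have := h1 _ (Finset.mem_image_of_mem _ hj) ((affine_injective ha).ne hne)
    rw [sr_affine] at this
    exact pos_of_mul_pos_right this ha.le
  · rw [← Finset.image_erase (affine_injective ha),
      Finset.sum_image (affine_injective ha).injOn] at h2
    -- Signal and interference both scale by `a ^ (-α)`, so the pulled-back powers work unchanged.
    have p := Real.rpow_pos_of_pos ha α
    simp only [sr_affine, len_affine, Real.mul_rpow ha.le (sr_nonneg _ _),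
      Real.mul_rpow ha.le (len_pos _).le, div_mul_eq_div_div_swap, ← Finset.sum_div] at h2
    rw [← mul_div_assoc, div_lt_div_iff_of_pos_right p] at h2
    exact h2

end Affine

/-! ### Towers and the iterated logarithm. -/

/-- The tower function `0 ↦ 1`, `n + 1 ↦ 2 ^ tower n`. -/
def tower : ℕ → ℕ
  | 0 => 1
  | n + 1 => 2 ^ tower n

theorem lt_tower (n : ℕ) : n < tower n := by
  induction n with
  | zero => exact Nat.one_pos
  | succ n ih => exact lt_of_le_of_lt ih (Nat.lt_two_pow_self)

/-- The form `m ≤ n` matters: `Real.logb` of a negative number is the logarithm of its absolute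
value, so iterates past the first one below `1` may exceed `1` again. -/
theorem exists_iterate_logb_le_one (n : ℕ) (x : ℝ) (hx : x ≤ tower n) :
    ∃ m ≤ n, (Real.logb 2)^[m] x ≤ 1 := by
  induction n generalizing x with
  | zero => exact ⟨0, le_rfl, by simpa [tower] using hx⟩
  | succ n ih =>
    rcases le_or_gt x 1 with h | h
    · exact ⟨0, Nat.zero_le _, h⟩
    · obtain ⟨m, hm, hmx⟩ := ih (Real.logb 2 x) (by
        rw [Real.logb_le_iff_le_rpow one_lt_two (by linarith), Real.rpow_natCast]
        simpa [tower] using hx)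
      exact ⟨m + 1, Nat.succ_le_succ hm, hmx⟩

theorem logStar_le {n : ℕ} {x : ℝ} (hx : x ≤ tower n) : logStar x ≤ n := by
  obtain ⟨m, hm, hmx⟩ := exists_iterate_logb_le_one n x hx
  exact (Nat.sInf_le hmx).trans hm

/-! ### The induction hypothesis and its base case. -/

/-- A set of links in `[0, 3]` with lengths in `[1 / N, 1]`, pairwise far apart, needing at least
`t` feasible classes. -/
structure IsHard (α β B R : ℝ) (t : ℕ) (N : ℝ) (L : Finset (Link ℝ)) : Prop where
  sender_mem : ∀ i ∈ L, i.sender ∈ Set.Icc (0 : ℝ) 3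
  receiver_mem : ∀ i ∈ L, i.receiver ∈ Set.Icc (0 : ℝ) 3
  len_le : ∀ i ∈ L, len i ≤ 1
  le_len : ∀ i ∈ L, 1 / N ≤ len i
  -- `R` is the threshold beyond which the bound on `f` holds, and `B` absorbs its constant and the
  -- factors of `β`.
  sep : ∀ i ∈ L, ∀ j ∈ L, i ≠ j → len i ≤ len j → R * len i ≤ len j ∧
    4 * len i * (B * Real.logb 2 (len j / len i) ^ (1 / α)) ≤ nodeDist i j
  -- Counting the colors that occur, not bounding their values, lets the hypothesis apply to a
  -- coloring restricted to a single copy.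
  colors : ∀ col : Link ℝ → ℕ, (∀ c, Feasible α β (L.filter fun i => col i = c)) →
    t ≤ (L.image col).card
  -- This makes the diversity unbounded in `t`, as needed for arbitrarily large `Δ`.
  spread : ∃ i ∈ L, ∃ j ∈ L, t * len i ≤ len j

theorem IsHard.mono {α β B R : ℝ} {t : ℕ} {N N' : ℝ} {L : Finset (Link ℝ)}
    (h : IsHard α β B R t N L) (hN : 0 < N) (hNN : N ≤ N') : IsHard α β B R t N' L :=
  { h with le_len := fun i hi => (one_div_le_one_div_of_le hN hNN).trans (h.le_len i hi) }

theorem isHard_one {α β B R N : ℝ} (hN : 1 ≤ N) :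
    IsHard α β B R 1 N {⟨0, 1, zero_ne_one⟩} := by
  have hl : len (⟨0, 1, zero_ne_one⟩ : Link ℝ) = 1 := by simp [len]
  constructor
  · simp
  · simp
  · simp [hl]
  · simpa [hl] using inv_le_one_of_one_le₀ hN
  · intro i hi j hj hne
    rw [Finset.mem_singleton] at hi hj
    exact absurd (hi.trans hj.symm) hne
  · simp
  · simp [hl]

/-! ### The positions of the copies. -/

/-- The position, relative to the long link, of the `k`-th scaled copy in the recursive
construction. -/
noncomputable def offset (α B : ℝ) (g k : ℕ) : ℝ :=
  4 * B * (1 / 2 ^ (g * (k + 1))) * (2 * (g * (k + 1))) ^ (1 / α)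

section Offset

variable {α B : ℝ} {g : ℕ}

theorem rpow_one_div_le_self (hα : 1 < α) {x : ℝ} (hx : 1 ≤ x) : x ^ (1 / α) ≤ x := by
  have h : 1 / α ≤ 1 := by rw [div_le_one (by linarith)]; exact hα.le
  simpa using Real.rpow_le_rpow_of_exponent_le hx h

theorem offset_zero_le (hα : 1 < α) (hB : 1 ≤ B) (hg : 1 ≤ g) (h : 8 * B * g ≤ 2 ^ g) :
    offset α B g 0 ≤ 1 := by
  have hg' : (1 : ℝ) ≤ g := by exact_mod_cast hg
  have h1 : (2 * (g : ℝ)) ^ (1 / α) ≤ 2 * g := rpow_one_div_le_self hα (by linarith)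
  have h2 : offset α B g 0 = 4 * B * (2 * (g : ℝ)) ^ (1 / α) / 2 ^ g := by
    simp only [offset, Nat.cast_zero, zero_add, mul_one]; ring
  rw [h2, div_le_one (by positivity)]
  nlinarith

theorem four_mul_scale_le_offset (hα : 1 < α) (hB : 1 ≤ B) (hg : 1 ≤ g) (k : ℕ) :
    4 * (1 / 2 ^ (g * (k + 1))) ≤ offset α B g k := by
  have hg' : (1 : ℝ) ≤ g := by exact_mod_cast hg
  have hk : (0 : ℝ) ≤ k := k.cast_nonneg
  have h1 : 1 ≤ (2 * ((g : ℝ) * (k + 1))) ^ (1 / α) :=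
    Real.one_le_rpow (by nlinarith) (by positivity)
  have h2 : (0 : ℝ) < 1 / 2 ^ (g * (k + 1)) := by positivity
  calc 4 * (1 / 2 ^ (g * (k + 1)) : ℝ) = 4 * 1 * (1 / 2 ^ (g * (k + 1))) * 1 := by ring
    _ ≤ _ := by unfold offset; gcongr

theorem offset_pos (hα : 1 < α) (hB : 1 ≤ B) (hg : 1 ≤ g) (k : ℕ) : 0 < offset α B g k :=
  lt_of_lt_of_le (by positivity) (four_mul_scale_le_offset hα hB hg k)

/-- From `k` to `k + 1` the scale shrinks by `2 ^ g ≥ 8`, while the root factor grows by at most `2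
^ (1 / α) ≤ 2`. -/
theorem four_mul_offset_succ_le (hα : 1 < α) (hB : 1 ≤ B) (hg : 3 ≤ g) (k : ℕ) :
    4 * offset α B g (k + 1) ≤ offset α B g k := by
  have hg' : (0 : ℝ) < g := by exact_mod_cast (by omega : 0 < g)
  have h1 : (2 * ((g : ℝ) * ((k + 1 : ℕ) + 1))) ^ (1 / α)
      ≤ 2 * (2 * ((g : ℝ) * (k + 1))) ^ (1 / α) := by
    calc (2 * ((g : ℝ) * ((k + 1 : ℕ) + 1))) ^ (1 / α)
        ≤ (2 * (2 * ((g : ℝ) * (k + 1)))) ^ (1 / α) := by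
          refine Real.rpow_le_rpow (by positivity) ?_ (by positivity)
          push_cast
          nlinarith [k.cast_nonneg (α := ℝ), mul_nonneg hg'.le (k.cast_nonneg (α := ℝ))]
      _ = 2 ^ (1 / α) * (2 * ((g : ℝ) * (k + 1))) ^ (1 / α) :=
          Real.mul_rpow (by norm_num) (by positivity)
      _ ≤ _ := by
          gcongr
          exact rpow_one_div_le_self hα one_le_two
  have h2 : (8 : ℝ) ≤ 2 ^ g := by
    calc (8 : ℝ) = 2 ^ 3 := by norm_num
      _ ≤ 2 ^ g := pow_le_pow_right₀ one_le_two hg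
  have h3 : (1 / 2 ^ (g * (k + 1 + 1)) : ℝ) ≤ 1 / 2 ^ (g * (k + 1)) / 8 := by
    rw [mul_add g (k + 1) 1, pow_add, mul_one, ← div_div]
    gcongr
  unfold offset
  have p : 0 ≤ (2 * ((g : ℝ) * (k + 1))) ^ (1 / α) := by positivity
  calc 4 * (4 * B * (1 / 2 ^ (g * (k + 1 + 1))) * (2 * ((g : ℝ) * ((k + 1 : ℕ) + 1))) ^ (1 / α))
      ≤ 4 * (4 * B * (1 / 2 ^ (g * (k + 1)) / 8) * (2 * (2 * ((g : ℝ) * (k + 1))) ^ (1 / α))) := by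
        gcongr
    _ = _ := by ring

theorem four_mul_offset_le_of_lt (hα : 1 < α) (hB : 1 ≤ B) (hg : 3 ≤ g) {k l : ℕ} (h : k < l) :
    4 * offset α B g l ≤ offset α B g k := by
  have hanti : Antitone (offset α B g) := antitone_nat_of_succ_le fun n => by
    linarith [four_mul_offset_succ_le hα hB hg n, offset_pos hα hB (by omega : 1 ≤ g) (n + 1)]
  exact (mul_le_mul_of_nonneg_left (hanti h) (by norm_num)).trans
    (four_mul_offset_succ_le hα hB hg k)

theorem offset_le_one (hα : 1 < α) (hB : 1 ≤ B) (hg : 3 ≤ g) (h : 8 * B * g ≤ 2 ^ g) (k : ℕ) :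
    offset α B g k ≤ 1 := by
  refine le_trans ?_ (offset_zero_le hα hB (by omega) h)
  rcases Nat.eq_zero_or_pos k with rfl | hk
  · rfl
  · linarith [four_mul_offset_le_of_lt hα hB hg hk, offset_pos hα hB (by omega : 1 ≤ g) k]

/-- A link of the `k`-th copy, of length `x`, tolerates longer links at distance `offset α B g k`. -/
theorem required_dist_le_offset (hα : 1 < α) (hB : 1 ≤ B) {N : ℝ} (hN : 0 < N)
    (hNg : N ≤ 2 ^ g) {k : ℕ} {x y : ℝ} (hx : 1 / 2 ^ (g * (k + 1)) * (1 / N) ≤ x)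
    (hx' : x ≤ 1 / 2 ^ (g * (k + 1))) (hxy : x ≤ y) (hy : y ≤ 1) :
    4 * x * (B * Real.logb 2 (y / x) ^ (1 / α)) ≤ offset α B g k := by
  have hx0 : 0 < x := lt_of_lt_of_le (by positivity) hx
  -- One factor `2 ^ g` pays for the spread `N` inside the copy. Then `k + 2 ≤ 2 * (k + 1)` gives
  -- the logarithm bound built into `offset`.
  have h1 : y / x ≤ 2 ^ (g * (k + 2)) := by
    rw [div_le_iff₀ hx0]
    have h2 : (1 : ℝ) ≤ 2 ^ (g * (k + 2)) * (1 / 2 ^ (g * (k + 1)) * (1 / N)) := by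
      rw [show g * (k + 2) = g * (k + 1) + g by ring, pow_add]
      have : (2 : ℝ) ^ (g * (k + 1)) * 2 ^ g * (1 / 2 ^ (g * (k + 1)) * (1 / N)) = 2 ^ g / N := by
        field_simp
      rw [this, one_le_div hN]
      exact hNg
    have h3 : (0 : ℝ) < 2 ^ (g * (k + 2)) := by positivity
    nlinarith
  have h4 : Real.logb 2 (y / x) ≤ 2 * (g * (k + 1)) := by
    rw [Real.logb_le_iff_le_rpow one_lt_two (div_pos (hx0.trans_le hxy) hx0)]
    refine h1.trans ?_
    rw [← Real.rpow_natCast]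
    refine Real.rpow_le_rpow_of_exponent_le one_le_two ?_
    push_cast
    nlinarith [mul_nonneg (g.cast_nonneg (α := ℝ)) (k.cast_nonneg (α := ℝ))]
  have h5 : 0 ≤ Real.logb 2 (y / x) := Real.logb_nonneg one_lt_two ((one_le_div hx0).2 hxy)
  have h6 := Real.rpow_le_rpow h5 h4 (by positivity : 0 ≤ 1 / α)
  calc 4 * x * (B * Real.logb 2 (y / x) ^ (1 / α))
      ≤ 4 * (1 / 2 ^ (g * (k + 1))) * (B * (2 * (g * (k + 1))) ^ (1 / α)) := by gcongr
    _ = offset α B g k := by unfold offset; ring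

/-- The divergence of the harmonic series, in the form that makes the long link infeasible. -/
theorem one_le_sum_offset (hα : 1 < α) (hB : 1 ≤ B) (hg : 1 ≤ g) {N : ℝ} (hN : 0 < N) {K : ℕ}
    (hK : (24 * B * N) ^ α * (2 * g) ≤ Real.log (K + 1)) :
    1 ≤ ∑ k ∈ Finset.range K,
      (1 / 2 ^ (g * (k + 1)) * (1 / N) / (6 * offset α B g k)) ^ α := by
  have hg' : (0 : ℝ) < g := by exact_mod_cast hg
  have hc : 0 < (24 * B * N) ^ α * (2 * g) := by positivity
  -- The scale cancels, and raising the `1 / α` power in `offset` to the power `α` leaves exactly a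
  -- harmonic term; `24` is `6 * 4`.
  have h1 : ∀ k : ℕ, (1 / 2 ^ (g * (k + 1)) * (1 / N) / (6 * offset α B g k)) ^ α
      = ((k + 1 : ℕ) : ℝ)⁻¹ / ((24 * B * N) ^ α * (2 * g)) := by
    intro k
    have h2 : 1 / 2 ^ (g * (k + 1)) * (1 / N) / (6 * offset α B g k)
        = (24 * B * N)⁻¹ * ((2 * ((g : ℝ) * (k + 1))) ^ (1 / α))⁻¹ := by
      have : (0 : ℝ) < (2 * (g * (k + 1))) ^ (1 / α) := by positivity
      unfold offset
      field_simp
      norm_num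
    rw [h2, Real.mul_rpow (by positivity) (by positivity), Real.inv_rpow (by positivity),
      Real.inv_rpow (by positivity), ← Real.rpow_mul (by positivity),
      one_div_mul_cancel (by linarith), Real.rpow_one]
    push_cast
    field_simp
  simp only [h1, ← Finset.sum_div]
  rw [one_le_div hc]
  refine hK.trans ?_
  have := log_add_one_le_harmonic K
  rw [harmonic] at this
  push_cast at this ⊢
  exact this

end Offset

/-! ### The recursive step. -/

section Step

variable {α β B R N : ℝ} {g : ℕ} {L : Finset (Link ℝ)}

/-- The link from `0` to `1`. -/
def unitLink : Link ℝ := ⟨0, 1, zero_ne_one⟩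

theorem len_unitLink : len unitLink = 1 := by simp [len, unitLink]

/-- The map placing the `k`-th scaled copy to the right of the unit link. -/
noncomputable def place (α B : ℝ) (g k : ℕ) : Link ℝ → Link ℝ :=
  affine (1 / 2 ^ (g * (k + 1))) (1 + offset α B g k) (by positivity)

theorem len_place (k : ℕ) (i : Link ℝ) :
    len (place α B g k i) = 1 / 2 ^ (g * (k + 1)) * len i := len_affine _ i

open Classical in
/-- The unit link together with `K` scaled copies of `L`. -/
noncomputable def extend (α B : ℝ) (g K : ℕ) (L : Finset (Link ℝ)) : Finset (Link ℝ) :=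
  insert unitLink ((Finset.range K).biUnion fun k => L.image (place α B g k))

theorem mem_extend {K : ℕ} {i : Link ℝ} : i ∈ extend α B g K L ↔
    i = unitLink ∨ ∃ k < K, ∃ j ∈ L, place α B g k j = i := by
  simp [extend]

/-- A copy has width at most three times its scale, which is less than its offset. -/
theorem place_coord_mem (hα : 1 < α) (hB : 1 ≤ B) (hg : 1 ≤ g) (k : ℕ) {x : ℝ}
    (hx : x ∈ Set.Icc (0 : ℝ) 3) :
    1 / 2 ^ (g * (k + 1)) * x + (1 + offset α B g k) ∈
      Set.Icc (1 + offset α B g k) (1 + 2 * offset α B g k) := by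
  have h1 := four_mul_scale_le_offset hα hB hg k
  have h2 : (0 : ℝ) < 1 / 2 ^ (g * (k + 1)) := by positivity
  constructor <;> nlinarith [hx.1, hx.2]

theorem le_nodeDist_of_nodes {i j : Link ℝ} {a b a' b' D : ℝ}
    (h1 : i.sender ∈ Set.Icc a b) (h2 : i.receiver ∈ Set.Icc a b)
    (h3 : j.sender ∈ Set.Icc a' b') (h4 : j.receiver ∈ Set.Icc a' b') (h : D ≤ a - b') :
    D ≤ nodeDist i j := by
  rw [le_nodeDist_iff]
  simp only [Real.dist_eq]
  obtain ⟨h1, -⟩ := h1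
  obtain ⟨h2, -⟩ := h2
  obtain ⟨-, h3⟩ := h3
  obtain ⟨-, h4⟩ := h4
  refine ⟨⟨?_, ?_⟩, ?_, ?_⟩ <;> refine le_trans ?_ (le_abs_self _) <;> linarith

namespace IsHard

variable {t : ℕ}

theorem le_len_place (h : IsHard α β B R t N L) (k : ℕ) {i : Link ℝ} (hi : i ∈ L) :
    1 / 2 ^ (g * (k + 1)) * (1 / N) ≤ len (place α B g k i) := by
  rw [len_place]
  exact mul_le_mul_of_nonneg_left (h.le_len i hi) (by positivity)

theorem len_place_le (h : IsHard α β B R t N L) (k : ℕ) {i : Link ℝ} (hi : i ∈ L) :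
    len (place α B g k i) ≤ 1 / 2 ^ (g * (k + 1)) := by
  rw [len_place]
  exact mul_le_of_le_one_right (by positivity) (h.len_le i hi)

theorem len_place_le_one (h : IsHard α β B R t N L)
    (k : ℕ) {i : Link ℝ} (hi : i ∈ L) : len (place α B g k i) ≤ 1 :=
  (h.len_place_le k hi).trans <| by
    rw [div_le_one (by positivity)]
    exact one_le_pow₀ one_le_two

theorem place_sender_mem (h : IsHard α β B R t N L)
    (hα : 1 < α) (hB : 1 ≤ B) (hg : 1 ≤ g) (k : ℕ) {i : Link ℝ}
    (hi : i ∈ L) : (place α B g k i).sender ∈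
      Set.Icc (1 + offset α B g k) (1 + 2 * offset α B g k) :=
  place_coord_mem hα hB hg k (h.sender_mem i hi)

theorem place_receiver_mem (h : IsHard α β B R t N L)
    (hα : 1 < α) (hB : 1 ≤ B) (hg : 1 ≤ g) (k : ℕ) {i : Link ℝ}
    (hi : i ∈ L) : (place α B g k i).receiver ∈
      Set.Icc (1 + offset α B g k) (1 + 2 * offset α B g k) :=
  place_coord_mem hα hB hg k (h.receiver_mem i hi)

theorem mul_len_place_le_one (h : IsHard α β B R t N L)
    (hN : 1 ≤ N) (hR : 0 ≤ R) (hRN : R * N ≤ 2 ^ g) (k : ℕ)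
    {i : Link ℝ} (hi : i ∈ L) : R * len (place α B g k i) ≤ 1 := by
  refine (mul_le_mul_of_nonneg_left (h.len_place_le k hi) hR).trans ?_
  rw [mul_one_div, div_le_one (by positivity)]
  calc R ≤ R * N := le_mul_of_one_le_right hR hN
    _ ≤ 2 ^ g := hRN
    _ ≤ _ := pow_le_pow_right₀ one_le_two (Nat.le_mul_of_pos_right g k.succ_pos)

/-- Consecutive scales differ by `2 ^ g ≥ R * N`: the factor `N` covers the spread of lengths within
a copy, and `R` remains. -/
theorem mul_len_place_le (h : IsHard α β B R t N L)
    (hN : 1 ≤ N) (hR : 0 ≤ R) (hRN : R * N ≤ 2 ^ g) {k l : ℕ} (hkl : k < l)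
    {i j : Link ℝ} (hi : i ∈ L) (hj : j ∈ L) :
    R * len (place α B g l i) ≤ len (place α B g k j) := by
  refine (mul_le_mul_of_nonneg_left (h.len_place_le l hi) hR).trans
    (le_trans ?_ (h.le_len_place k hj))
  have h1 : (2 : ℝ) ^ (g * (k + 1)) * (R * N) ≤ 2 ^ (g * (l + 1)) := by
    calc (2 : ℝ) ^ (g * (k + 1)) * (R * N) ≤ 2 ^ (g * (k + 1)) * 2 ^ g := by gcongr
      _ = 2 ^ (g * (k + 2)) := by rw [← pow_add]; ring_nf
      _ ≤ _ := pow_le_pow_right₀ one_le_two (Nat.mul_le_mul_left g (by omega))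
  have hN0 : 0 < N := by linarith
  rw [mul_one_div, one_div_mul_one_div, div_le_div_iff₀ (by positivity) (by positivity)]
  linarith

/-- Two links of the extension are well separated. -/
theorem extend_sep (h : IsHard α β B R t N L)
    (hα : 1 < α) (hB : 1 ≤ B) (hR : 2 ≤ R) (hN : 1 ≤ N) (hg : 3 ≤ g)
    (hRN : R * N ≤ 2 ^ g) (K : ℕ) :
    ∀ i ∈ extend α B g K L, ∀ j ∈ extend α B g K L, i ≠ j → len i ≤ len j → R * len i ≤ len j ∧
      4 * len i * (B * Real.logb 2 (len j / len i) ^ (1 / α)) ≤ nodeDist i j := by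
  have hN0 : 0 < N := by linarith
  have hR0 : 0 ≤ R := by linarith
  have hg1 : 1 ≤ g := by omega
  have hNg : N ≤ 2 ^ g := by nlinarith
  have hlt : ∀ {x y : ℝ}, 0 < x → R * x ≤ y → x < y := fun hx hxy => by nlinarith
  intro i hi j hj hne hij
  rw [mem_extend] at hi hj
  rcases hi with rfl | ⟨k, hk, i, hi, rfl⟩
  · rcases hj with rfl | ⟨l, hl, j, hj, rfl⟩
    · exact absurd rfl hne
    · exfalso
      rw [len_unitLink] at hij
      exact (hlt (len_pos _) (h.mul_len_place_le_one hN hR0 hRN l hj)).not_ge hij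
  · rcases hj with rfl | ⟨l, hl, j, hj, rfl⟩
    · refine ⟨by rw [len_unitLink]; exact h.mul_len_place_le_one hN hR0 hRN k hi, ?_⟩
      refine (required_dist_le_offset hα hB hN0 hNg (h.le_len_place k hi) (h.len_place_le k hi)
        hij len_unitLink.le).trans ?_
      refine le_nodeDist_of_nodes (h.place_sender_mem hα hB hg1 k hi)
        (h.place_receiver_mem hα hB hg1 k hi) (a' := 0) (b' := 1) ?_ ?_ ?_
      · simp [unitLink]
      · simp [unitLink]
      · linarith
    -- Higher-indexed copies have shorter links and lie nearer to the unit link. Within one copy the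
    -- claim is inherited by scaling; for `l < k` the gap is `offset α B g l - 2 * offset α B g k`,
    -- at least `2 * offset α B g k`.
    · rcases lt_trichotomy k l with hkl | rfl | hkl
      · exact absurd hij (hlt (len_pos _) (h.mul_len_place_le hN hR0 hRN hkl hj hi)).not_ge
      · have hne' : i ≠ j := fun e => hne (by rw [e])
        have hs : (0 : ℝ) < 1 / 2 ^ (g * (k + 1)) := by positivity
        have hij' : len i ≤ len j := by
          rw [len_place, len_place] at hij
          exact le_of_mul_le_mul_left hij hs
        obtain ⟨h1, h2⟩ := h.sep i hi j hj hne' hij'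
        constructor
        · rw [len_place, len_place]
          nlinarith
        · rw [len_place, len_place, mul_div_mul_left _ _ hs.ne']
          refine le_trans (le_of_eq ?_) ((mul_le_mul_of_nonneg_left h2 hs.le).trans
            (nodeDist_affine _ i j).ge)
          ring
      · refine ⟨h.mul_len_place_le hN hR0 hRN hkl hi hj, ?_⟩
        refine (required_dist_le_offset hα hB hN0 hNg (h.le_len_place k hi) (h.len_place_le k hi)
          hij (h.len_place_le_one l hj)).trans ?_
        rw [nodeDist_comm]
        refine le_nodeDist_of_nodes (h.place_sender_mem hα hB hg1 l hj)
          (h.place_receiver_mem hα hB hg1 l hj) (h.place_sender_mem hα hB hg1 k hi)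
          (h.place_receiver_mem hα hB hg1 k hi) ?_
        linarith [four_mul_offset_le_of_lt hα hB hg hkl, offset_pos hα hB hg1 k]

/-- A feasible set containing the unit link misses one of the copies. -/
theorem not_feasible (h : IsHard α β B R t N L)
    (hα : 1 < α) (hβ : 1 ≤ β) (hB : 1 ≤ B) (hR : 2 ≤ R) (hN : 1 ≤ N)
    (hg : 3 ≤ g) (hRN : R * N ≤ 2 ^ g) (hBg : 8 * B * g ≤ 2 ^ g) {K : ℕ}
    (hK : (24 * B * N) ^ α * (2 * g) ≤ Real.log (K + 1)) {S : Finset (Link ℝ)}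
    (hu : unitLink ∈ S) {e : ℕ → Link ℝ} (he : ∀ k < K, e k ∈ L)
    (heS : ∀ k < K, place α B g k (e k) ∈ S) : ¬ Feasible α β S := by
  intro hS
  have hN0 : 0 < N := by linarith
  have hR0 : 0 ≤ R := by linarith
  have hg1 : 1 ≤ g := by omega
  have hinj : Set.InjOn (fun k => place α B g k (e k)) (Finset.range K) := by
    have key : ∀ k l, k < l → l < K → place α B g k (e k) ≠ place α B g l (e l) := by
      intro k l hkl hl heq
      have h1 := h.mul_len_place_le (g := g) hN hR0 hRN hkl (he l hl) (he k (hkl.trans hl))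
      rw [heq] at h1
      nlinarith [len_pos (place α B g l (e l))]
    intro k hk l hl heq
    simp only [Finset.coe_range, Set.mem_Iio] at hk hl
    rcases lt_trichotomy k l with hkl | rfl | hkl
    · exact absurd heq (key k l hkl hl)
    · rfl
    · exact absurd heq.symm (key l k hkl hk)
  have h1 := hS.sum_lt_one hβ hu hinj (fun k hk => heS k (Finset.mem_range.1 hk)) (by
    intro k hk heq
    have h1 := h.mul_len_place_le_one (g := g) hN hR0 hRN k (he k (Finset.mem_range.1 hk))
    replace heq : place α B g k (e k) = unitLink := heq
    rw [heq, len_unitLink] at h1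
    linarith)
  refine h1.not_ge ((one_le_sum_offset hα hB hg1 hN0 hK).trans ?_)
  refine Finset.sum_le_sum fun k hk => ?_
  have hk := he k (Finset.mem_range.1 hk)
  have hD := offset_pos hα hB hg1 k
  have hD1 := offset_le_one hα hB hg hBg k
  obtain ⟨s1, s2⟩ := h.place_sender_mem hα hB hg1 k hk
  obtain ⟨r1, r2⟩ := h.place_receiver_mem hα hB hg1 k hk
  have e1 : sr (place α B g k (e k)) unitLink = (place α B g k (e k)).sender - 1 := by
    simp only [sr, unitLink, Real.dist_eq]
    exact abs_of_nonneg (by linarith)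
  have e2 : sr unitLink (place α B g k (e k)) = (place α B g k (e k)).receiver := by
    simp only [sr, unitLink, Real.dist_eq, zero_sub, abs_neg]
    exact abs_of_nonneg (by linarith)
  rw [len_unitLink, mul_one, e1, e2]
  refine Real.rpow_le_rpow (by positivity) ?_ (by linarith)
  refine div_le_div₀ (len_pos _).le (h.le_len_place k hk)
    (mul_pos (by linarith) (by linarith)) ?_
  -- The copy's sender is within `2 * offset α B g k` of the receiver `1`, and its receiver is
  -- within `3` of the sender `0`; hence the `6` in `one_le_sum_offset`.
  calc _ ≤ (2 * offset α B g k) * 3 := mul_le_mul (by linarith) (by linarith) (by linarith)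
        (by linarith)
    _ = _ := by ring

/-- The extension of a hard set needs one more feasible class. -/
theorem succ (h : IsHard α β B R t N L)
    (hα : 1 < α) (hβ : 1 ≤ β) (hB : 1 ≤ B) (hR : 2 ≤ R) (hN : 1 ≤ N) (ht : 1 ≤ t)
    (hg : 3 ≤ g) (hRN : R * N ≤ 2 ^ g) (hBg : 8 * B * g ≤ 2 ^ g) {K : ℕ} (hK0 : 0 < K)
    (hK : (24 * B * N) ^ α * (2 * g) ≤ Real.log (K + 1)) :
    IsHard α β B R (t + 1) (N * 2 ^ (g * K)) (extend α B g K L) := by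
  classical
  have hN0 : 0 < N := by linarith
  have hR0 : 0 ≤ R := by linarith
  have hg1 : 1 ≤ g := by omega
  have hIcc : ∀ k, Set.Icc (1 + offset α B g k) (1 + 2 * offset α B g k) ⊆ Set.Icc 0 3 := fun k =>
    Set.Icc_subset_Icc (by linarith [offset_pos hα hB hg1 k])
      (by linarith [offset_le_one hα hB hg hBg k])
  constructor
  · intro i hi
    rcases mem_extend.1 hi with rfl | ⟨k, hk, j, hj, rfl⟩
    · simp [unitLink]
    · exact hIcc k (h.place_sender_mem hα hB hg1 k hj)
  · intro i hi
    rcases mem_extend.1 hi with rfl | ⟨k, hk, j, hj, rfl⟩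
    · norm_num [unitLink]
    · exact hIcc k (h.place_receiver_mem hα hB hg1 k hj)
  · intro i hi
    rcases mem_extend.1 hi with rfl | ⟨k, hk, j, hj, rfl⟩
    · exact len_unitLink.le
    · exact h.len_place_le_one k hj
  · intro i hi
    rcases mem_extend.1 hi with rfl | ⟨k, hk, j, hj, rfl⟩
    · rw [len_unitLink, div_le_one (by positivity)]
      exact one_le_mul_of_one_le_of_one_le hN (one_le_pow₀ one_le_two)
    · refine le_trans ?_ (h.le_len_place k hj)
      rw [mul_comm N, ← one_div_mul_one_div]
      gcongr
      · exact one_le_two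
      · omega
  · exact h.extend_sep hα hB hR hN hg hRN K
  · intro col hcol
    have hsub : ∀ k < K, L.image (fun i => col (place α B g k i)) ⊆
        (extend α B g K L).image col := by
      intro k hk c hc
      obtain ⟨i, hi, rfl⟩ := Finset.mem_image.1 hc
      exact Finset.mem_image_of_mem _ (mem_extend.2 (Or.inr ⟨k, hk, i, hi, rfl⟩))
    have hcard : ∀ k < K, t ≤ (L.image (fun i => col (place α B g k i))).card := by
      intro k hk
      refine h.colors _ fun c => ?_
      refine Feasible.of_image_affine (a := 1 / 2 ^ (g * (k + 1))) (b := 1 + offset α B g k)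
        (by positivity) ((hcol c).mono (by linarith) ?_)
      intro i hi
      obtain ⟨j, hj, rfl⟩ := Finset.mem_image.1 hi
      rw [Finset.mem_filter] at hj ⊢
      exact ⟨mem_extend.2 (Or.inr ⟨k, hk, j, hj.1, rfl⟩), hj.2⟩
    have hu : unitLink ∈ extend α B g K L := mem_extend.2 (Or.inl rfl)
    -- Either the unit link's color occurs in every copy, against `not_feasible`, or it is a new
    -- color on top of the `t` colors of a copy that misses it.
    by_cases hc : ∀ k < K, ∃ i ∈ L, col (place α B g k i) = col unitLink
    · have : Nonempty (Link ℝ) := ⟨unitLink⟩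
      choose! e he hec using hc
      refine absurd (hcol (col unitLink)) (h.not_feasible hα hβ hB hR hN hg hRN hBg hK
        (Finset.mem_filter.2 ⟨hu, rfl⟩) he fun k hk => Finset.mem_filter.2 ⟨?_, hec k hk⟩)
      exact mem_extend.2 (Or.inr ⟨k, hk, e k, he k hk, rfl⟩)
    · push Not at hc
      obtain ⟨k, hk, hc⟩ := hc
      have hlt := Finset.card_lt_card ((Finset.ssubset_iff_of_subset (hsub k hk)).2
        ⟨col unitLink, Finset.mem_image_of_mem _ hu, fun hmem => by
          obtain ⟨i, hi, hic⟩ := Finset.mem_image.1 hmem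
          exact hc i hi hic⟩)
      exact Nat.succ_le_of_lt (lt_of_le_of_lt (hcard k hk) hlt)
  · obtain ⟨i, hi, j, hj, hij⟩ := h.spread
    refine ⟨place α B g 0 i, mem_extend.2 (Or.inr ⟨0, hK0, i, hi, rfl⟩), unitLink,
      mem_extend.2 (Or.inl rfl), ?_⟩
    have h1 := h.mul_len_place_le_one (g := g) hN hR0 hRN 0 hj
    have h2 : t * len (place α B g 0 i) ≤ len (place α B g 0 j) := by
      rw [len_place, len_place, mul_left_comm]
      exact mul_le_mul_of_nonneg_left hij (by positivity)
    have ht' : (1 : ℝ) ≤ t := by exact_mod_cast ht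
    rw [len_unitLink]
    push_cast
    nlinarith [len_pos (place α B g 0 i), len_pos (place α B g 0 j)]

end IsHard

end Step

/-! ### Growth of the length ratio along the recursion. -/

theorem eventually_const_mul_pow_le_two_pow (C : ℝ) (a : ℕ) :
    ∀ᶠ M : ℕ in atTop, C * (M : ℝ) ^ a ≤ 2 ^ M := by
  have h := (isLittleO_pow_const_const_pow_of_one_lt (R := ℝ) a one_lt_two).def
    (c := 1 / (|C| + 1)) (by positivity)
  filter_upwards [h] with M hM
  rw [Real.norm_of_nonneg (by positivity), Real.norm_of_nonneg (by positivity),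
    one_div_mul_eq_div, le_div_iff₀ (by positivity)] at hM
  have h1 : (0 : ℝ) ≤ (M : ℝ) ^ a := by positivity
  nlinarith [le_abs_self C]

/-- The left side is the new ratio `N * 2 ^ (g * K)` for `N = g = M` and `K = 2 ^ n`. -/
theorem mul_two_pow_le_two_pow_two_pow {M n : ℕ} (h : 2 * M + n ≤ 2 ^ M) :
    M * 2 ^ (M * 2 ^ n) ≤ 2 ^ 2 ^ 2 ^ M := by
  have hM : M < 2 ^ M := Nat.lt_two_pow_self
  have h1 : M + M * 2 ^ n ≤ 2 ^ (2 * M + n) := by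
    have h2 : M + M * 2 ^ n ≤ 2 * M * 2 ^ n := by nlinarith [Nat.one_le_two_pow (n := n)]
    refine h2.trans ?_
    rw [pow_add]
    exact Nat.mul_le_mul_right _ Nat.lt_two_pow_self.le
  calc M * 2 ^ (M * 2 ^ n) ≤ 2 ^ M * 2 ^ (M * 2 ^ n) := Nat.mul_le_mul_right _ hM.le
    _ = 2 ^ (M + M * 2 ^ n) := (pow_add _ _ _).symm
    _ ≤ 2 ^ 2 ^ (2 * M + n) := Nat.pow_le_pow_right two_pos h1
    _ ≤ _ := Nat.pow_le_pow_right two_pos (Nat.pow_le_pow_right two_pos h)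

theorem half_le_log_two_pow_add_one (n : ℕ) : (n : ℝ) / 2 ≤ Real.log ((2 ^ n : ℕ) + 1) := by
  have h1 : Real.log ((2 : ℝ) ^ n) ≤ Real.log ((2 ^ n : ℕ) + 1) :=
    Real.log_le_log (by positivity) (by push_cast; linarith)
  rw [Real.log_pow] at h1
  have h2 : (1 : ℝ) / 2 ≤ Real.log 2 := by linarith [Real.log_two_gt_d9]
  nlinarith [n.cast_nonneg (α := ℝ)]

/-- For large `M`, a hard set with parameter `M` extends to one with parameter `2 ^ 2 ^ 2 ^ M`. -/
theorem eventually_isHard_succ {α β B R : ℝ} (hα : 1 < α) (hβ : 1 ≤ β) (hB : 1 ≤ B)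
    (hR : 2 ≤ R) : ∀ᶠ M : ℕ in atTop, ∀ t : ℕ, 1 ≤ t → ∀ L : Finset (Link ℝ),
      IsHard α β B R t M L → ∃ L', IsHard α β B R (t + 1) ((2 ^ 2 ^ 2 ^ M : ℕ) : ℝ) L' := by
  obtain ⟨a, ha⟩ := exists_nat_ge α
  have hBa : 0 ≤ (24 * B) ^ a := by positivity
  filter_upwards [eventually_ge_atTop 3, eventually_const_mul_pow_le_two_pow R 1,
    eventually_const_mul_pow_le_two_pow (8 * B) 1,
    eventually_const_mul_pow_le_two_pow (4 * (24 * B) ^ a + 3) (a + 1)] with M hM3 h1 h2 h3 t ht L h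
  rw [pow_one] at h1 h2
  have hM1 : (1 : ℝ) ≤ M := by exact_mod_cast (by omega : 1 ≤ M)
  have h24 : 1 ≤ 24 * B * M := by nlinarith
  have hMa : (M : ℝ) ≤ M ^ (a + 1) := le_self_pow₀ hM1 (by omega)
  -- With `K = 2 ^ n` the harmonic sum is at least `n / 2`, so `n` is twice the required `(24 * B *
  -- M) ^ α * (2 * M)`. It is polynomially bounded in `M`, hence `2 * M + n ≤ 2 ^ M` for large `M`.
  set n : ℕ := ⌈(24 * B * M) ^ α * (4 * M)⌉₊ with hn
  have hnle := Nat.le_ceil ((24 * B * M) ^ α * (4 * M))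
  have hnlt := Nat.ceil_lt_add_one (by positivity : 0 ≤ (24 * B * M) ^ α * (4 * M))
  rw [← hn] at hnle hnlt
  have hpow : (24 * B * M) ^ α ≤ (24 * B) ^ a * M ^ a := by
    rw [← mul_pow, ← Real.rpow_natCast]
    exact Real.rpow_le_rpow_of_exponent_le h24 ha
  have hsum : 2 * M + n ≤ 2 ^ M := by
    have h4 : (24 * B * M) ^ α * (4 * M) ≤ 4 * (24 * B) ^ a * M ^ (a + 1) := by
      calc (24 * B * M) ^ α * (4 * M) ≤ (24 * B) ^ a * M ^ a * (4 * M) := by gcongr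
        _ = _ := by ring
    have h5 : (2 * M + n : ℝ) ≤ 2 ^ M := by nlinarith
    exact_mod_cast h5
  have hK : (24 * B * M) ^ α * (2 * M) ≤ Real.log ((2 ^ n : ℕ) + 1) := by
    refine le_trans ?_ (half_le_log_two_pow_add_one n)
    linarith
  refine ⟨_, (h.succ hα hβ hB hR hM1 ht hM3 h1 h2 (by positivity) hK).mono (by positivity) ?_⟩
  exact_mod_cast mul_two_pow_le_two_pow_two_pow hsum

theorem exists_isHard_tower {α β B R : ℝ} (hα : 1 < α) (hβ : 1 ≤ β) (hB : 1 ≤ B)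
    (hR : 2 ≤ R) : ∃ m : ℕ, ∀ t : ℕ, ∃ L, IsHard α β B R (t + 1) (tower (3 * t + m)) L := by
  obtain ⟨m, hm⟩ := eventually_atTop.1 (eventually_isHard_succ hα hβ hB hR)
  refine ⟨m, fun t => ?_⟩
  induction t with
  | zero => exact ⟨_, isHard_one (by exact_mod_cast (Nat.zero_le _).trans_lt (lt_tower _))⟩
  | succ t ih =>
    obtain ⟨L, hL⟩ := ih
    obtain ⟨L', hL'⟩ := hm (tower (3 * t + m)) (by have := lt_tower (3 * t + m); omega)
      (t + 1) (by omega) L hL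
    refine ⟨L', ?_⟩
    rw [show 3 * (t + 1) + m = 3 * t + m + 1 + 1 + 1 by ring]
    exact hL'

/-! ### Diversity, partitions and conflict graphs of hard sets. -/

theorem sens_div_sens {X : Type*} [MetricSpace X] {α β : ℝ} (hβ : 0 < β) (i j : Link X) :
    sens α β i / sens α β j = len i / len j :=
  mul_div_mul_left _ _ (Real.rpow_pos_of_pos hβ _).ne'

namespace IsHard

variable {α β B R N : ℝ} {t : ℕ} {L : Finset (Link ℝ)}

theorem len_div_len_le (h : IsHard α β B R t N L) (hN : 0 < N) {i j : Link ℝ} (hi : i ∈ L)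
    (hj : j ∈ L) : len i / len j ≤ N := by
  rw [div_le_iff₀ (len_pos j)]
  have := h.le_len j hj
  rw [div_le_iff₀ hN] at this
  linarith [h.len_le i hi]

theorem diversity_le (h : IsHard α β B R t N L) (hβ : 0 < β) (hN : 0 < N) :
    diversity α β L ≤ N := by
  obtain ⟨i, hi, j, hj, -⟩ := h.spread
  refine csSup_le ⟨_, i, hi, j, hj, rfl⟩ ?_
  rintro x ⟨i, hi, j, hj, rfl⟩
  rw [sens_div_sens hβ]
  exact h.len_div_len_le hN hi hj

theorem le_diversity (h : IsHard α β B R t N L) (hβ : 0 < β) (hN : 0 < N) :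
    (t : ℝ) ≤ diversity α β L := by
  obtain ⟨i, hi, j, hj, hij⟩ := h.spread
  have hbdd : BddAbove {x : ℝ | ∃ i ∈ L, ∃ j ∈ L, x = sens α β i / sens α β j} := by
    refine ⟨N, ?_⟩
    rintro x ⟨i, hi, j, hj, rfl⟩
    rw [sens_div_sens hβ]
    exact h.len_div_len_le hN hi hj
  refine le_trans ?_ (le_csSup hbdd ⟨j, hj, i, hi, rfl⟩)
  rw [sens_div_sens hβ, le_div_iff₀ (len_pos i)]
  exact hij

theorem le_of_canPartition (h : IsHard α β B R t N L) {k : ℕ} (hk : CanPartition α β L k) :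
    t ≤ k := by
  obtain ⟨col, hlt, hcol⟩ := hk
  have hsub : L.image col ⊆ Finset.range k := by
    intro c hc
    obtain ⟨i, hi, rfl⟩ := Finset.mem_image.1 hc
    exact Finset.mem_range.2 (hlt i hi)
  refine (h.colors col fun c => ?_).trans
    ((Finset.card_le_card hsub).trans (Finset.card_range k).le)
  by_cases hc : c < k
  · exact hcol c hc
  -- Colors from `k` on give empty classes, which are trivially feasible.
  · rw [Finset.filter_eq_empty_iff.2 fun i hi (e : col i = c) => hc (e ▸ hlt i hi)]
    exact ⟨fun _ => 1, fun _ => one_pos, fun i hi => absurd hi (Finset.notMem_empty i)⟩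

/-- No two links of a hard set are adjacent in either conflict graph. -/
theorem not_conflict (h : IsHard α β B R t N L) (hα : 1 < α) (hβ : 1 ≤ β) (hB : 1 ≤ B)
    (hR : 2 ≤ R) {f : ℝ → ℝ} {c : ℝ} (hc : 0 ≤ c)
    (hf : ∀ x, R ≤ x → f x ≤ c * Real.logb 2 x ^ (1 / α))
    (hcB : β ^ (1 / α) * β ^ (1 / α) * c ≤ B) {i j : Link ℝ} (hi : i ∈ L) (hj : j ∈ L)
    (hne : i ≠ j) (hij : len i ≤ len j) :
    sens α β i * sens α β j * f (max (sens α β i) (sens α β j) / min (sens α β i) (sens α β j)) ≤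
        sr i j * sr j i ∧
      min (sens α β i) (sens α β j) *
        f (max (sens α β i) (sens α β j) / min (sens α β i) (sens α β j)) ≤ nodeDist i j := by
  have hli := len_pos i
  have hlj := len_pos j
  have hb : 1 ≤ β ^ (1 / α) := Real.one_le_rpow hβ (by positivity)
  have hsens : sens α β i ≤ sens α β j := mul_le_mul_of_nonneg_left hij (by linarith)
  rw [max_eq_right hsens, min_eq_left hsens, sens_div_sens (by linarith)]
  obtain ⟨h1, h2⟩ := h.sep i hi j hj hne hij
  have hratio : R ≤ len j / len i := (le_div_iff₀ hli).2 h1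
  have hlog : 1 ≤ Real.logb 2 (len j / len i) ^ (1 / α) := by
    refine Real.one_le_rpow ?_ (by positivity)
    rw [Real.le_logb_iff_rpow_le one_lt_two (by positivity), Real.rpow_one]
    linarith
  have hfx := hf _ hratio
  set y := Real.logb 2 (len j / len i) ^ (1 / α)
  set b := β ^ (1 / α) with hbdef
  have hBy : 1 ≤ B * y := one_le_mul_of_one_le_of_one_le hB hlog
  -- The product form of adjacency carries two sensitivity factors `b`, the simplified form only
  -- one.
  have hbf : b * b * f (len j / len i) ≤ B * y := by
    calc b * b * f (len j / len i) ≤ b * b * (c * y) := by gcongr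
      _ = b * b * c * y := by ring
      _ ≤ B * y := by gcongr
  have hbf' : b * f (len j / len i) ≤ B * y := by
    calc b * f (len j / len i) ≤ b * (c * y) := by gcongr
      _ ≤ b * (b * (c * y)) := le_mul_of_one_le_left (by positivity) hb
      _ = b * b * c * y := by ring
      _ ≤ B * y := by gcongr
  have hs : ∀ k : Link ℝ, sens α β k = b * len k := fun k => rfl
  rw [hs, hs]
  constructor
  · refine le_trans ?_ (mul_le_sr_mul_sr hBy h2)
    calc b * len i * (b * len j) * f (len j / len i)
        = len i * len j * (b * b * f (len j / len i)) := by ring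
      _ ≤ _ := by gcongr
  · refine le_trans ?_ h2
    calc b * len i * f (len j / len i) = len i * (b * f (len j / len i)) := by ring
      _ ≤ len i * (B * y) := by gcongr
      _ ≤ _ := by nlinarith [mul_pos hli (by linarith : 0 < B * y)]

theorem conflictGraph_eq_bot (h : IsHard α β B R t N L) (hα : 1 < α) (hβ : 1 ≤ β) (hB : 1 ≤ B)
    (hR : 2 ≤ R) {f : ℝ → ℝ} {c : ℝ} (hc : 0 ≤ c)
    (hf : ∀ x, R ≤ x → f x ≤ c * Real.logb 2 x ^ (1 / α))
    (hcB : β ^ (1 / α) * β ^ (1 / α) * c ≤ B) : conflictGraph α β f L = ⊥ := by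
  have key : ∀ i j : {i : Link ℝ // i ∈ L}, len i.1 ≤ len j.1 →
      ¬ (conflictGraph α β f L).Adj i j := fun i j hij hadj =>
    ((h.not_conflict hα hβ hB hR hc hf hcB i.2 j.2 (Subtype.coe_injective.ne hadj.1)
      hij).1).not_gt hadj.2
  refine SimpleGraph.eq_bot_iff_forall_not_adj.2 fun i j hadj => ?_
  rcases le_total (len i.1) (len j.1) with hij | hij
  · exact key i j hij hadj
  · exact key j i hij hadj.symm

theorem conflictGraphUniform_eq_bot (h : IsHard α β B R t N L) (hα : 1 < α) (hβ : 1 ≤ β)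
    (hB : 1 ≤ B) (hR : 2 ≤ R) {f : ℝ → ℝ} {c : ℝ} (hc : 0 ≤ c)
    (hf : ∀ x, R ≤ x → f x ≤ c * Real.logb 2 x ^ (1 / α))
    (hcB : β ^ (1 / α) * β ^ (1 / α) * c ≤ B) : conflictGraphUniform α β f L = ⊥ := by
  have key : ∀ i j : {i : Link ℝ // i ∈ L}, len i.1 ≤ len j.1 →
      ¬ (conflictGraphUniform α β f L).Adj i j := fun i j hij hadj =>
    ((h.not_conflict hα hβ hB hR hc hf hcB i.2 j.2 (Subtype.coe_injective.ne hadj.1)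
      hij).2).not_gt hadj.2
  refine SimpleGraph.eq_bot_iff_forall_not_adj.2 fun i j hadj => ?_
  rcases le_total (len i.1) (len j.1) with hij | hij
  · exact key i j hij hadj
  · exact key j i hij hadj.symm

end IsHard

end SINR

theorem theoremT (α : ℝ) (hα : 1 < α) (β : ℝ) (hβ : 1 ≤ β) (f : ℝ → ℝ)
    (hf : f =O[atTop] fun x : ℝ => Real.logb 2 x ^ (1 / α)) :
    ∃ c₁ : ℝ, 0 < c₁ ∧ ∃ c₂ : ℝ, 0 < c₂ ∧ ∀ Δ : ℝ, 0 < Δ →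
      ∃ L : Finset (SINR.Link ℝ),
        c₁ * Δ ≤ SINR.diversity α β L ∧
        SINR.conflictGraph α β f L = ⊥ ∧
        SINR.conflictGraphUniform α β f L = ⊥ ∧
        ∀ k : ℕ, SINR.CanPartition α β L k →
          c₂ * (SINR.logStar (SINR.diversity α β L) : ℝ) ≤ (k : ℝ) := by
  obtain ⟨c, hc, hfc⟩ := hf.exists_nonneg
  obtain ⟨x₀, hx₀⟩ := eventually_atTop.1 hfc.bound
  set b := β ^ (1 / α) with hbdef
  have hb : 1 ≤ b := Real.one_le_rpow hβ (by positivity)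
  have hB : 1 ≤ b * b * (c + 1) := by
    have : 1 ≤ b * b := one_le_mul_of_one_le_of_one_le hb hb
    exact one_le_mul_of_one_le_of_one_le this (by linarith)
  have hcB : b * b * c ≤ b * b * (c + 1) := by gcongr; linarith
  have hR : 2 ≤ max 2 x₀ := le_max_left _ _
  have hbound : ∀ x, max 2 x₀ ≤ x → f x ≤ c * Real.logb 2 x ^ (1 / α) := by
    intro x hx
    have h2 : 2 ≤ x := hR.trans hx
    have h1 := hx₀ x ((le_max_right _ _).trans hx)
    have h3 : 0 ≤ Real.logb 2 x := Real.logb_nonneg one_lt_two (by linarith)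
    rw [Real.norm_of_nonneg (Real.rpow_nonneg h3 _)] at h1
    exact (le_abs_self _).trans h1
  obtain ⟨m, hm⟩ := SINR.exists_isHard_tower hα hβ hB hR
  -- The value of `c₂` comes from `3 * t + m ≤ (3 + m) * (t + 1)`.
  refine ⟨1, one_pos, 1 / (3 + m), by positivity, fun Δ _ => ?_⟩
  obtain ⟨t, ht⟩ := exists_nat_ge Δ
  obtain ⟨L, hL⟩ := hm t
  have hβ0 : 0 < β := by linarith
  have hN : (0 : ℝ) < SINR.tower (3 * t + m) :=
    Nat.cast_pos.2 ((Nat.zero_le _).trans_lt (SINR.lt_tower _))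
  refine ⟨L, ?_, hL.conflictGraph_eq_bot hα hβ hB hR hc hbound hcB,
    hL.conflictGraphUniform_eq_bot hα hβ hB hR hc hbound hcB, fun k hk => ?_⟩
  · have := hL.le_diversity hβ0 hN
    push_cast at this
    linarith
  · have h1 : ((t + 1 : ℕ) : ℝ) ≤ k := by exact_mod_cast hL.le_of_canPartition hk
    have h2 : (SINR.logStar (SINR.diversity α β L) : ℝ) ≤ ((3 * t + m : ℕ) : ℝ) := by
      exact_mod_cast SINR.logStar_le (hL.diversity_le hβ0 hN)
    push_cast at h1 h2
    rw [one_div_mul_eq_div, div_le_iff₀ (by positivity)]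
    have hm0 : (0 : ℝ) ≤ m := m.cast_nonneg
    have ht0 : (0 : ℝ) ≤ t := t.cast_nonneg
    nlinarith
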